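/- Let $f\colon\mathbb{C}\to\mathbb{C}$, $f(z)=e^z$, be the complex exponential map, and for $z_0\in\mathbb{C}$ let the orbit of $z_0$ be the sequence $(z_n)_{n\ge 0}$ defined by $z_n=e^{z_{n-1}}$ for $n\ge 1$, i.e. $z_n=f^n(z_0)$. Each of the following three sets is dense in the complex plane: 1. the set of starting values $z_0\in\mathbb{C}$ whose orbit diverges to $\infty$, i.e. $|z_n|\to\infty$ as $n\to\infty$; 2. the set of starting values $z_0\in\mathbb{C}$ whose orbit forms a dense subset of the plane, i.e. $\{z_n : n\ge 0\}$ is dense in $\mathbb{C}$; 3. the set of periodic points, i.e. of starting values $z_0\in\mathbb{C}$ such that there is an integer $k>0$ with $z_{n+k}=z_n$ for all $n\ge 0$. -/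

import Mathlib

open Filter

open Set Metric Topology
open scoped NNReal

/-! The key is `exists_exp_iterate_real`: orbits starting in any nonempty open set reach the real
line, where they escape to infinity. Otherwise, Schwarz–Pick bounds the increasing hyperbolic
derivatives of the iterates, which forces Im z_n → 0; the dynamics near the real axis forbid this.
Along a real orbit exp eventually expands strongly, so its inverse branches contract and can be
chained: `HasInverseBranch.exists_into_open` pulls a disc about any v ≠ 0 into any given nonempty
open set by a 1/2-Lipschitz branch. This transitivity gives dense orbits by Baire, and periodic
points by Banach's fixed point theorem. -/

theorem add_nat_le_exp_iterate (x : ℝ) (n : ℕ) : x + n ≤ Real.exp^[n] x := by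
  induction n with
  | zero => simp
  | succ n ih =>
    rw [Function.iterate_succ_apply']
    have := Real.add_one_le_exp (Real.exp^[n] x)
    push_cast
    linarith

theorem tendsto_real_exp_iterate (x : ℝ) : Tendsto (fun n : ℕ => Real.exp^[n] x) atTop atTop :=
  tendsto_atTop_mono (add_nat_le_exp_iterate x)
    (tendsto_atTop_add_const_left _ x tendsto_natCast_atTop_atTop)

theorem exp_iterate_ofReal (x : ℝ) (n : ℕ) : Complex.exp^[n] (x : ℂ) = (Real.exp^[n] x : ℝ) := by
  induction n with
  | zero => simp
  | succ n ih => rw [Function.iterate_succ_apply', Function.iterate_succ_apply', ih, Complex.ofReal_exp]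

theorem abs_im_exp (z : ℂ) : |(Complex.exp z).im| = Real.exp z.re * |Real.sin z.im| := by
  rw [Complex.exp_im, abs_mul, abs_of_pos (Real.exp_pos _)]

/-! ### Schwarz–Pick and sine estimates -/

/-- The Schwarz lemma applied to g followed by the Cayley transform that sends g c to 0. -/
theorem norm_deriv_le_of_im_pos {g : ℂ → ℂ} {c : ℂ} {r : ℝ} (hr : 0 < r)
    (hg : DifferentiableOn ℂ g (ball c r)) (him : ∀ z ∈ ball c r, 0 < (g z).im) :
    ‖deriv g c‖ ≤ 2 * (g c).im / r := by
  have hc : c ∈ ball c r := mem_ball_self hr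
  have hy := him c hc
  set b := (starRingEnd ℂ) (g c) with hb
  have hne : ∀ z ∈ ball c r, g z - b ≠ 0 := by
    intro z hz h
    have h1 := congrArg Complex.im h
    have h2 := him z hz
    simp [hb] at h1
    linarith
  set φ : ℂ → ℂ := fun z => (g z - g c) / (g z - b) with hφ
  have hd : DifferentiableOn ℂ φ (ball c r) :=
    (hg.sub_const _).div (hg.sub_const _) hne
  have hφc : φ c = 0 := by simp [hφ]
  have hmaps : MapsTo φ (ball c r) (closedBall (φ c) 1) := by
    intro z hz
    rw [hφc, mem_closedBall_zero_iff, hφ]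
    simp only [norm_div]
    rw [div_le_one (norm_pos_iff.2 (hne z hz)), ← sq_le_sq₀ (norm_nonneg _) (norm_nonneg _),
      ← Complex.normSq_eq_norm_sq, ← Complex.normSq_eq_norm_sq, Complex.normSq_apply,
      Complex.normSq_apply]
    have := mul_pos hy (him z hz)
    simp [hb]
    nlinarith
  have hS := Complex.norm_deriv_le_div_of_mapsTo_ball hd hmaps hr
  have hgc : HasDerivAt g (deriv g c) c :=
    ((hg c hc).differentiableAt (isOpen_ball.mem_nhds hc)).hasDerivAt
  have hder : deriv φ c = deriv g c / (g c - b) := by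
    have := ((hgc.sub_const (g c)).div (hgc.sub_const b) (hne c hc)).deriv
    have e : deriv φ c = _ := this
    rw [e]
    have := hne c hc
    field_simp
    ring
  have hnorm : ‖g c - b‖ = 2 * (g c).im := by
    have : g c - b = ((2 * (g c).im : ℝ) : ℂ) * Complex.I := by
      rw [hb]
      apply Complex.ext <;> simp
      ring
    rw [this, norm_mul, Complex.norm_I, mul_one, Complex.norm_real, Real.norm_of_nonneg (by positivity)]
  rw [hder, norm_div, hnorm, div_le_iff₀ (by positivity)] at hS
  calc _ ≤ _ := hS
    _ = _ := by ring

theorem norm_deriv_le_of_im_ne_zero {g : ℂ → ℂ} {c : ℂ} {r : ℝ} (hr : 0 < r)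
    (hg : DifferentiableOn ℂ g (ball c r)) (him : ∀ z ∈ ball c r, (g z).im ≠ 0) :
    ‖deriv g c‖ ≤ 2 * |(g c).im| / r := by
  have hc : c ∈ ball c r := mem_ball_self hr
  have hcont : ContinuousOn (fun z => (g z).im) (ball c r) :=
    Complex.continuous_im.comp_continuousOn hg.continuousOn
  have hconn : IsPreconnected ((fun z => (g z).im) '' ball c r) :=
    (convex_ball c r).isPreconnected.image _ hcont
  have hord := hconn.ordConnected
  have h0 : (0 : ℝ) ∉ (fun z => (g z).im) '' ball c r := by
    rintro ⟨z, hz, h⟩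
    exact him z hz h
  rcases lt_or_gt_of_ne (him c hc) with h | h
  · have hneg : ∀ z ∈ ball c r, 0 < ((-g) z).im := by
      intro z hz
      by_contra hcon
      simp only [Pi.neg_apply, Complex.neg_im, not_lt] at hcon
      exact h0 (hord.out (mem_image_of_mem _ hc) (mem_image_of_mem _ hz) ⟨h.le, by linarith⟩)
    have := norm_deriv_le_of_im_pos hr hg.neg hneg
    rw [deriv.neg, norm_neg] at this
    simpa [abs_of_neg h] using this
  · have hpos : ∀ z ∈ ball c r, 0 < (g z).im := by
      intro z hz
      by_contra hcon
      exact h0 (hord.out (mem_image_of_mem _ hz) (mem_image_of_mem _ hc) ⟨by linarith, h.le⟩)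
    simpa [abs_of_pos h] using norm_deriv_le_of_im_pos hr hg hpos

theorem exists_abs_sin_le_mul {ε : ℝ} (hε : 0 < ε) :
    ∃ q < 1, ∀ y : ℝ, ε ≤ |y| → |Real.sin y| ≤ q * |y| := by
  have hπ := Real.pi_gt_three
  refine ⟨max (1 / 2) (1 - 2 / Real.pi ^ 2 * (ε / 2) ^ 2),
    max_lt (by norm_num) (sub_lt_self _ (by positivity)), fun y hy => ?_⟩
  rcases le_total 2 |y| with h | h
  · calc |Real.sin y| ≤ 1 := Real.abs_sin_le_one y
      _ ≤ 1 / 2 * |y| := by linarith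
      _ ≤ _ := by gcongr; exact le_max_left _ _
  · have hhalf : |(y / 2)| ≤ 1 := by rw [abs_div, abs_two]; linarith
    have hcos0 : 0 ≤ Real.cos (y / 2) := (Real.cos_pos_of_le_one hhalf).le
    have hcos : Real.cos (y / 2) ≤ 1 - 2 / Real.pi ^ 2 * (ε / 2) ^ 2 := by
      refine (Real.cos_le_one_sub_mul_cos_sq (by linarith)).trans ?_
      rw [← sq_abs (y / 2), abs_div, abs_two]
      gcongr
    have hsin : |Real.sin y| = 2 * |Real.sin (y / 2)| * Real.cos (y / 2) := by
      conv_lhs => rw [show y = 2 * (y / 2) by ring, Real.sin_two_mul]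
      rw [abs_mul, abs_mul, abs_two, abs_of_nonneg hcos0]
    have h1 : 2 * |Real.sin (y / 2)| ≤ |y| := by
      have := Real.abs_sin_le_abs (x := y / 2)
      rw [abs_div, abs_two] at this
      linarith
    rw [hsin, mul_comm _ |y|]
    exact mul_le_mul h1 (hcos.trans (le_max_right _ _)) hcos0 (abs_nonneg _)

/-! ### Orbits from open sets reach the real line -/

theorem differentiable_exp_iterate (n : ℕ) : Differentiable ℂ (Complex.exp^[n]) :=
  Differentiable.iterate Complex.differentiable_exp n

theorem deriv_exp_iterate_succ (n : ℕ) (z : ℂ) :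
    deriv (Complex.exp^[n + 1]) z = Complex.exp (Complex.exp^[n] z) * deriv (Complex.exp^[n]) z := by
  rw [Function.iterate_succ']
  exact ((differentiable_exp_iterate n z).hasDerivAt.cexp).deriv

/-- Once y is small, cos y ≥ 7/8 makes x grow by at least 1/2 per step. When x ≥ 1, the factor e^x ≥
2 outweighs |sin y| ≥ |y|/2, so |y| no longer decreases. -/
theorem not_tendsto_im_zero_of_recurrence {x y : ℕ → ℝ}
    (hx : ∀ n, x (n + 1) = Real.exp (x n) * Real.cos (y n))
    (hy : ∀ n, |y (n + 1)| = Real.exp (x n) * |Real.sin (y n)|) (h0 : ∀ n, y n ≠ 0) :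
    ¬ Tendsto y atTop (𝓝 0) := by
  intro hlim
  have hev : ∀ᶠ n in atTop, |y n| < 1 / 2 := by
    have := hlim.abs
    rw [abs_zero] at this
    exact this.eventually_lt_const (by norm_num)
  obtain ⟨N, hN⟩ := eventually_atTop.1 hev
  have hstep : ∀ n ≥ N, x n + 1 / 2 ≤ x (n + 1) := by
    intro n hn
    have h1 := abs_lt.1 (hN n hn)
    have hcos : 7 / 8 ≤ Real.cos (y n) := by
      have := Real.one_sub_sq_div_two_le_cos (x := y n)
      nlinarith
    have h2 : 7 / 8 * Real.exp (x n) ≤ x (n + 1) := by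
      rw [hx, mul_comm]
      gcongr
    rcases le_total 0 (x n) with h | h
    · have := Real.quadratic_le_exp_of_nonneg h
      nlinarith [sq_nonneg (x n - 1)]
    · have := Real.add_one_le_exp (x n)
      linarith
  have hgrow : ∀ k : ℕ, x N + k / 2 ≤ x (N + k) := by
    intro k
    induction k with
    | zero => simp
    | succ k ih =>
      have := hstep (N + k) (by omega)
      rw [← add_assoc]
      push_cast
      linarith
  obtain ⟨k, hk⟩ := exists_nat_gt (2 * (1 - x N))
  have hlarge : ∀ j : ℕ, 1 ≤ x (N + k + j) := by
    intro j
    have := hgrow (k + j)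
    rw [← add_assoc] at this
    push_cast at this
    have hj : (0 : ℝ) ≤ j := j.cast_nonneg
    linarith
  have hmono : Monotone fun j => |y (N + k + j)| := by
    refine monotone_nat_of_le_succ fun j => ?_
    have hπ := Real.pi_gt_three
    have hπ4 := Real.pi_le_four
    have hs := Real.mul_abs_le_abs_sin (x := y (N + k + j))
      (by have := hN (N + k + j) (by omega); linarith)
    have he : 2 ≤ Real.exp (x (N + k + j)) := by
      have := Real.add_one_le_exp (x (N + k + j))
      linarith [hlarge j]
    rw [← add_assoc, hy]
    have h2 : 1 / 2 ≤ 2 / Real.pi := by rw [div_le_div_iff₀] <;> linarith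
    calc |y (N + k + j)| = 2 * (1 / 2 * |y (N + k + j)|) := by ring
      _ ≤ 2 * (2 / Real.pi * |y (N + k + j)|) := by gcongr
      _ ≤ _ := by gcongr
  have hlim' : Tendsto (fun j => |y (N + k + j)|) atTop (𝓝 0) := by
    have := (hlim.comp (tendsto_add_atTop_nat (N + k))).abs
    rw [abs_zero] at this
    refine this.congr fun j => ?_
    simp [add_comm]
  exact (abs_pos.2 (h0 (N + k + 0))).not_ge (hmono.ge_of_tendsto hlim' 0)

theorem exists_exp_iterate_real {V : Set ℂ} (hV : IsOpen V) (hne : V.Nonempty) :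
    ∃ z ∈ V, ∃ (n : ℕ) (x : ℝ), Complex.exp^[n] z = x := by
  by_contra! hcon
  have him : ∀ z ∈ V, ∀ n, (Complex.exp^[n] z).im ≠ 0 := fun z hz n h =>
    hcon z hz n (Complex.exp^[n] z).re (Complex.ext (by simp) (by simpa using h))
  obtain ⟨z, hz⟩ := hne
  obtain ⟨r, hr, hrV⟩ := Metric.isOpen_iff.1 hV z hz
  set u : ℕ → ℂ := fun n => Complex.exp^[n] z with hu
  have hu1 : ∀ n, u (n + 1) = Complex.exp (u n) := fun n => Function.iterate_succ_apply' _ _ _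
  have hu0 : ∀ n, (u n).im ≠ 0 := him z hz
  have hupos : ∀ n, 0 < |(u n).im| := fun n => abs_pos.2 (hu0 n)
  -- Hyperbolic derivative of the n-th iterate; a (n + 1) / a n = |y| / |sin y| ≥ 1 with y = Im z_n,
  -- and this ratio tends to 1 only if y → 0.
  set a : ℕ → ℝ := fun n => ‖deriv (Complex.exp^[n]) z‖ / |(u n).im| with ha
  have hsin : ∀ n, 0 < |Real.sin (u n).im| := by
    intro n
    have h := hupos (n + 1)
    rw [hu1, abs_im_exp] at h
    exact pos_of_mul_pos_right h (Real.exp_pos _).le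
  have hstep : ∀ n, a (n + 1) * |Real.sin (u n).im| = a n * |(u n).im| := by
    intro n
    have h1 := (hupos n).ne'
    have h2 := (hsin n).ne'
    have h3 := (Real.exp_pos (u n).re).ne'
    have h4 : Complex.exp^[n] z = u n := rfl
    simp only [ha]
    rw [deriv_exp_iterate_succ, hu1, abs_im_exp, norm_mul, h4, Complex.norm_exp]
    field_simp
  have hapos : ∀ n, 0 < a n := by
    intro n
    induction n with
    | zero => simp only [ha, Function.iterate_zero, deriv_id]; simpa using hu0 0
    | succ n ih =>
      have h := mul_pos ih (hupos n)
      rw [← hstep] at h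
      exact pos_of_mul_pos_left h (hsin n).le
  have hmono : Monotone a := by
    refine monotone_nat_of_le_succ fun n => ?_
    refine le_of_mul_le_mul_right ?_ (hsin n)
    rw [hstep]
    exact mul_le_mul_of_nonneg_left Real.abs_sin_le_abs (hapos n).le
  have hbdd : BddAbove (range a) := by
    refine ⟨2 / r, ?_⟩
    rintro _ ⟨n, rfl⟩
    simp only [ha]
    rw [div_le_iff₀ (hupos n)]
    calc _ ≤ _ := norm_deriv_le_of_im_ne_zero hr (differentiable_exp_iterate n).differentiableOn
            fun w hw => him w (hrV hw) n
      _ = _ := by ring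
  have hlim := tendsto_atTop_ciSup hmono hbdd
  set L := ⨆ n, a n
  have hL : 0 < L := (hapos 0).trans_le (hmono.ge_of_tendsto hlim 0)
  have hquot : Tendsto (fun n => a n / a (n + 1)) atTop (𝓝 1) := by
    have := hlim.div (hlim.comp (tendsto_add_atTop_nat 1)) hL.ne'
    rwa [div_self hL.ne'] at this
  refine not_tendsto_im_zero_of_recurrence (x := fun n => (u n).re) (y := fun n => (u n).im)
    (fun n => ?_) (fun n => ?_) hu0 ?_
  · rw [hu1, Complex.exp_re]
  · rw [hu1, abs_im_exp]
  · rw [Metric.tendsto_atTop']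
    intro ε hε
    obtain ⟨q, hq, hsinq⟩ := exists_abs_sin_le_mul hε
    obtain ⟨N, hN⟩ := eventually_atTop.1 (hquot.eventually_const_lt hq)
    refine ⟨N, fun n hn => ?_⟩
    rw [Real.dist_0_eq_abs]
    by_contra! h
    have h1 := hsinq _ h
    have h2 := (lt_div_iff₀ (hapos (n + 1))).1 (hN n hn.le)
    have h3 := hstep n
    have h4 := mul_le_mul_of_nonneg_left h1 (hapos (n + 1)).le
    have h5 := mul_lt_mul_of_pos_right h2 (hupos n)
    nlinarith

/-! ### Contracting inverse branches -/

/-- `exp^[m]` has a `K`-Lipschitz right inverse on `A` with values in `B`. -/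
def HasInverseBranch (m : ℕ) (K : ℝ≥0) (A B : Set ℂ) : Prop :=
  ∃ g : ℂ → ℂ, MapsTo g A B ∧ LipschitzOnWith K g A ∧ ∀ w ∈ A, Complex.exp^[m] (g w) = w

namespace HasInverseBranch

theorem mono {m : ℕ} {K K' : ℝ≥0} {A A' B B' : Set ℂ} (h : HasInverseBranch m K A B)
    (hK : K ≤ K') (hA : A' ⊆ A) (hB : B ⊆ B') : HasInverseBranch m K' A' B' := by
  obtain ⟨g, h1, h2, h3⟩ := h
  exact ⟨g, h1.mono hA hB, (h2.mono hA).weaken hK, fun w hw => h3 w (hA hw)⟩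

theorem comp {m n : ℕ} {K K' : ℝ≥0} {A B C : Set ℂ} (h : HasInverseBranch m K A B)
    (h' : HasInverseBranch n K' B C) : HasInverseBranch (m + n) (K' * K) A C := by
  obtain ⟨g, h1, h2, h3⟩ := h
  obtain ⟨g', h1', h2', h3'⟩ := h'
  refine ⟨g' ∘ g, h1'.comp h1, h2'.comp h2 h1, fun w hw => ?_⟩
  rw [Function.iterate_add_apply, Function.comp_apply, h3' _ (h1 hw), h3 w hw]

theorem refl (A : Set ℂ) : HasInverseBranch 0 1 A A :=
  ⟨id, mapsTo_id A, LipschitzWith.id.lipschitzOnWith, fun _ _ => rfl⟩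

/-- The branch is w ↦ ℓ + log(w/c) with c = exp ℓ. On the disc, w/c stays in the right half-plane
and |w| ≥ |c|/2, so the derivative 1/w has norm at most 2/|c|. -/
theorem log {ℓ : ℂ} {s : ℝ} {K : ℝ≥0} (hs : 0 ≤ s) (hs' : s ≤ ‖Complex.exp ℓ‖ / 2)
    (hK : 2 / ‖Complex.exp ℓ‖ ≤ K) :
    HasInverseBranch 1 K (closedBall (Complex.exp ℓ) s) (closedBall ℓ (K * s)) := by
  set c := Complex.exp ℓ with hc
  have hc0 : c ≠ 0 := Complex.exp_ne_zero ℓ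
  have hcpos : 0 < ‖c‖ := norm_pos_iff.2 hc0
  have hslit : ∀ w ∈ closedBall c s, w / c ∈ Complex.slitPlane := by
    intro w hw
    refine Or.inl ?_
    have h1 : ‖w / c - 1‖ ≤ 1 / 2 := by
      rw [div_sub_one hc0, norm_div, div_le_iff₀ hcpos]
      have := mem_closedBall_iff_norm.1 hw
      linarith
    have h2 := (abs_le.1 ((Complex.abs_re_le_norm _).trans h1)).1
    simp at h2
    linarith
  have hlip : LipschitzOnWith K (fun w => ℓ + Complex.log (w / c)) (closedBall c s) := by
    refine (convex_closedBall c s).lipschitzOnWith_of_nnnorm_hasDerivWithin_le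
      (f' := fun w => 1 / c / (w / c))
      (fun w hw => ((((hasDerivAt_id w).div_const c).clog
        (hslit w hw)).const_add ℓ).hasDerivWithinAt) fun w hw => ?_
    rw [← NNReal.coe_le_coe, coe_nnnorm]
    refine le_trans ?_ hK
    have h1 := mem_closedBall_iff_norm'.1 hw
    have h2 : ‖c‖ / 2 ≤ ‖w‖ := by
      have := norm_sub_norm_le c w
      linarith
    rw [div_div_div_cancel_right₀ hc0, norm_div, norm_one, div_le_div_iff₀ (by linarith) hcpos]
    linarith
  refine ⟨_, fun w hw => ?_, hlip, fun w hw => ?_⟩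
  · have := hlip.dist_le_mul w hw c (mem_closedBall_self hs)
    simp only [div_self hc0, Complex.log_one, add_zero] at this
    rw [mem_closedBall]
    exact this.trans (by gcongr; exact hw)
  · have : w / c ≠ 0 := Complex.slitPlane_ne_zero (hslit w hw)
    simp only [Function.iterate_one]
    rw [Complex.exp_add, Complex.exp_log this, ← hc, mul_div_cancel₀ _ hc0]

theorem exists_near (n : ℕ) (z : ℂ) {ε : ℝ} (hε : 0 < ε) :
    ∃ (K : ℝ≥0) (s : ℝ), 0 < s ∧
      HasInverseBranch n K (closedBall (Complex.exp^[n] z) s) (closedBall z ε) := by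
  induction n generalizing z ε with
  | zero => exact ⟨1, ε, hε, refl _⟩
  | succ n ih =>
    have hpos : 0 < ‖Complex.exp z‖ := norm_pos_iff.2 (Complex.exp_ne_zero z)
    set K : ℝ≥0 := ⟨2 / ‖Complex.exp z‖, by positivity⟩ with hK
    have hK' : (K : ℝ) = 2 / ‖Complex.exp z‖ := rfl
    have hKpos : (0 : ℝ) < K := by rw [hK']; positivity
    set t := min (‖Complex.exp z‖ / 2) (ε / K) with ht
    have htpos : 0 < t := lt_min (by positivity) (by positivity)
    obtain ⟨K', s, hs, h⟩ := ih (Complex.exp z) htpos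
    have h1 := log (ℓ := z) htpos.le (min_le_left _ _) hK'.ge
    refine ⟨_, s, hs, (h.comp h1).mono le_rfl subset_rfl (closedBall_subset_closedBall ?_)⟩
    calc K * t ≤ K * (ε / K) := by gcongr; exact min_le_right _ _
      _ = ε := by field_simp

theorem real {x R : ℝ} (hR : 0 ≤ R) (hx : 2 * R + 4 ≤ x) (k : ℕ) :
    HasInverseBranch k ((1 / 2) ^ k) (closedBall ((Real.exp^[k] x : ℝ) : ℂ) R)
      (closedBall (x : ℂ) (R / 2 ^ k)) := by
  induction k generalizing x with
  | zero => simpa using refl (closedBall (x : ℂ) R)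
  | succ k ih =>
    have hxe := Real.add_one_le_exp x
    have h := ih (x := Real.exp x) (by linarith)
    have hn : ‖Complex.exp (x : ℂ)‖ = Real.exp x := by rw [Complex.norm_exp, Complex.ofReal_re]
    have hle : R / 2 ^ k ≤ R := div_le_self hR (one_le_pow₀ one_le_two)
    have h1 := log (ℓ := (x : ℂ)) (s := R / 2 ^ k) (K := 1 / 2) (by positivity)
      (by rw [hn]; linarith) (by
        rw [hn, div_le_iff₀ (Real.exp_pos x)]
        push_cast
        linarith)
    rw [← Complex.ofReal_exp] at h1
    refine (h.comp h1).mono (by rw [pow_succ, mul_comm]) (by rw [Function.iterate_succ_apply])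
      (closedBall_subset_closedBall ?_)
    push_cast
    rw [pow_succ]
    apply le_of_eq
    field_simp

/-- Large circles centred at 0 leave the real axis: with T = e^X, the point iT has logarithm X +
iπ/2 near X, while v has a logarithm within bounded distance of iT. -/
theorem crossing {v : ℂ} (hv : v ≠ 0) :
    ∃ T₀ : ℝ, ∀ X : ℝ, T₀ ≤ Real.exp X →
      HasInverseBranch 2 (1 * ⟨2 / ‖v‖, by positivity⟩) (closedBall v (‖v‖ / 2))
        (closedBall (X : ℂ) 10) := by
  have hvpos : 0 < ‖v‖ := norm_pos_iff.2 hv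
  set M := ‖Complex.log v‖ + 2 * Real.pi + 1 with hM
  have hMpos : 0 < M := by have := Real.pi_pos; positivity
  refine ⟨max 2 (2 * M), fun X hX => ?_⟩
  set T := Real.exp X with hT
  have hT2 : 2 ≤ T := (le_max_left _ _).trans hX
  have hTM : 2 * M ≤ T := (le_max_right _ _).trans hX
  have hπ := Real.pi_pos
  set k := ⌊T / (2 * Real.pi)⌋ with hk
  set ℓ : ℂ := Complex.log v + k * (2 * Real.pi * Complex.I) with hℓ
  have hexp : Complex.exp ℓ = v := by
    rw [hℓ, Complex.exp_add, Complex.exp_log hv, Complex.exp_int_mul_two_pi_mul_I, mul_one]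
  have hexpX : Complex.exp ((X : ℂ) + Real.pi / 2 * Complex.I) = T * Complex.I := by
    rw [Complex.exp_add, Complex.exp_pi_div_two_mul_I, ← Complex.ofReal_exp]
  have hnormX : ‖Complex.exp ((X : ℂ) + Real.pi / 2 * Complex.I)‖ = T := by
    rw [hexpX, norm_mul, Complex.norm_I, mul_one, Complex.norm_real, Real.norm_of_nonneg (by linarith)]
  have h1 := log (ℓ := ℓ) (s := ‖v‖ / 2) (K := ⟨2 / ‖v‖, by positivity⟩) (by positivity)
    (by rw [hexp]) (by rw [hexp]; exact le_rfl)
  have h2 := log (ℓ := (X : ℂ) + Real.pi / 2 * Complex.I) (s := M)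
    (K := ⟨2 / T, by positivity⟩) hMpos.le (by rw [hnormX]; linarith) (by rw [hnormX]; exact le_rfl)
  rw [hexp] at h1
  rw [hexpX] at h2
  have hkT : |(k : ℝ) * (2 * Real.pi) - T| ≤ 2 * Real.pi := by
    have a1 := Int.floor_le (T / (2 * Real.pi))
    have a2 := (Int.lt_floor_add_one (T / (2 * Real.pi))).le
    rw [le_div_iff₀ (by positivity)] at a1
    rw [div_le_iff₀ (by positivity)] at a2
    rw [abs_le]
    constructor <;> nlinarith
  refine (h1.mono le_rfl subset_rfl ?_).comp (h2.mono ?_ subset_rfl ?_)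
  · refine closedBall_subset_closedBall' ?_
    have e1 : (2 / ‖v‖) * (‖v‖ / 2) = 1 := by field_simp
    have e2 : ℓ - T * Complex.I
        = Complex.log v + (((k : ℝ) * (2 * Real.pi) - T : ℝ) : ℂ) * Complex.I := by
      rw [hℓ]
      push_cast
      ring
    rw [dist_eq_norm, e2]
    refine (add_le_add e1.le (norm_add_le _ _)).trans ?_
    rw [norm_mul, Complex.norm_I, mul_one, Complex.norm_real, Real.norm_eq_abs]
    linarith
  · exact NNReal.coe_le_coe.1 ((div_le_one (by linarith)).2 hT2)
  · refine closedBall_subset_closedBall' ?_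
    have e1 : (2 / T) * M ≤ 1 := by
      rw [div_mul_eq_mul_div, div_le_one (by linarith)]
      exact hTM
    have e2 : dist ((X : ℂ) + Real.pi / 2 * Complex.I) X = Real.pi / 2 := by
      rw [dist_eq_norm, add_sub_cancel_left, norm_mul, Complex.norm_I, mul_one]
      rw [← Complex.ofReal_ofNat, ← Complex.ofReal_div, Complex.norm_real,
        Real.norm_of_nonneg (by positivity)]
    rw [e2]
    have := Real.pi_le_four
    exact (add_le_add_left e1 _).trans (by linarith)

theorem exists_into_open {U : Set ℂ} (hU : IsOpen U) (hne : U.Nonempty) {v : ℂ} (hv : v ≠ 0) :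
    ∃ m, 0 < m ∧ HasInverseBranch m (1 / 2) (closedBall v (‖v‖ / 2)) U := by
  obtain ⟨z, hz, n, x₀, hx₀⟩ := exists_exp_iterate_real hU hne
  obtain ⟨i, hi⟩ := ((tendsto_real_exp_iterate x₀).eventually_ge_atTop (2 * 10 + 4)).exists
  set x := Real.exp^[i] x₀ with hx
  have hzx : Complex.exp^[i + n] z = x := by
    rw [Function.iterate_add_apply, hx₀, exp_iterate_ofReal]
  obtain ⟨ε, hε, hεU⟩ := Metric.nhds_basis_closedBall.mem_iff.1 (hU.mem_nhds hz)
  obtain ⟨K, s, hs, h1⟩ := exists_near (i + n) z hε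
  rw [hzx] at h1
  obtain ⟨T₀, hT₀⟩ := crossing hv
  set C : ℝ≥0 := 1 * ⟨2 / ‖v‖, by positivity⟩ with hC
  have hpow : Tendsto (fun j : ℕ => (1 / 2 : ℝ) ^ j) atTop (𝓝 0) :=
    tendsto_pow_atTop_nhds_zero_of_lt_one (by norm_num) (by norm_num)
  have hpow' : Tendsto (fun j : ℕ => (1 / 2 : ℝ≥0) ^ j) atTop (𝓝 0) :=
    NNReal.tendsto_pow_atTop_nhds_zero_of_lt_one (by
      rw [← NNReal.coe_lt_coe]; norm_num)
  have ev1 : ∀ᶠ j : ℕ in atTop, 10 * (1 / 2 : ℝ) ^ j < s := by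
    have := hpow.const_mul 10
    rw [mul_zero] at this
    exact this.eventually_lt_const hs
  have ev2 : ∀ᶠ j : ℕ in atTop, K * (1 / 2 : ℝ≥0) ^ j * C < 1 / 2 := by
    have := (hpow'.const_mul K).mul_const C
    rw [mul_zero, zero_mul] at this
    exact this.eventually_lt_const (by positivity)
  have ev3 := (Real.tendsto_exp_atTop.comp (tendsto_real_exp_iterate x)).eventually_ge_atTop T₀
  -- Following the real orbit long enough, the factor 2^(-j) beats the radius s and the fixed
  -- constants K and C.
  obtain ⟨j, hj1, hj2, hj3⟩ := (ev1.and (ev2.and ev3)).exists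
  have h2 := real (R := 10) (by norm_num) hi j
  have h3 := hT₀ _ hj3
  refine ⟨_, ?_, (h3.comp ((h2.mono le_rfl subset_rfl (closedBall_subset_closedBall ?_)).comp
    h1)).mono hj2.le subset_rfl hεU⟩
  · omega
  · calc (10 : ℝ) / 2 ^ j = 10 * (1 / 2) ^ j := by rw [one_div, inv_pow]; rfl
      _ ≤ s := hj1.le

theorem exists_fixed {m : ℕ} {v : ℂ} {ρ : ℝ} (hρ : 0 ≤ ρ)
    (h : HasInverseBranch m (1 / 2) (closedBall v ρ) (closedBall v ρ)) :
    ∃ p ∈ closedBall v ρ, Complex.exp^[m] p = p := by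
  obtain ⟨g, h1, h2, h3⟩ := h
  have hc : ContractingWith (1 / 2) (h1.restrict g _ _) :=
    ⟨by rw [← NNReal.coe_lt_coe]; norm_num, h2.mapsToRestrict h1⟩
  obtain ⟨p, hp, hfix, -⟩ := hc.exists_fixedPoint' isClosed_closedBall.isComplete h1
    (mem_closedBall_self hρ) (edist_ne_top _ _)
  refine ⟨p, hp, ?_⟩
  have := h3 p hp
  rwa [hfix] at this

end HasInverseBranch

theorem dense_escaping :
    Dense {z : ℂ | Tendsto (fun n : ℕ => Complex.exp^[n] z) atTop (Bornology.cobounded ℂ)} := by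
  rw [dense_iff_inter_open]
  intro U hU hne
  obtain ⟨z, hz, n, x, hx⟩ := exists_exp_iterate_real hU hne
  refine ⟨z, hz, ?_⟩
  rw [mem_ofPred_eq, ← tendsto_add_atTop_iff_nat n, ← tendsto_norm_atTop_iff_cobounded]
  refine tendsto_atTop_mono (fun k => ?_) (tendsto_real_exp_iterate x)
  rw [Function.iterate_add_apply, hx, exp_iterate_ofReal, Complex.norm_real]
  exact Real.le_norm_self _

theorem IsOpen.exists_ne_zero {U : Set ℂ} (hU : IsOpen U) (hne : U.Nonempty) : ∃ v ∈ U, v ≠ 0 := by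
  obtain ⟨v, hv, hvU⟩ := (dense_compl_singleton (0 : ℂ)).inter_open_nonempty U hU hne
  exact ⟨v, hv, hvU⟩

theorem exists_exp_iterate_mem {U V : Set ℂ} (hU : IsOpen U) (hUne : U.Nonempty) (hV : IsOpen V)
    (hVne : V.Nonempty) : ∃ z ∈ U, ∃ m : ℕ, Complex.exp^[m] z ∈ V := by
  obtain ⟨v, hv, hv0⟩ := hV.exists_ne_zero hVne
  obtain ⟨m, -, g, h1, -, h3⟩ := HasInverseBranch.exists_into_open hU hUne hv0
  have hvm : v ∈ closedBall v (‖v‖ / 2) := mem_closedBall_self (by positivity)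
  exact ⟨g v, h1 hvm, m, by rwa [h3 v hvm]⟩

theorem dense_dense_orbit :
    Dense {z : ℂ | Dense (range (fun n : ℕ => Complex.exp^[n] z))} := by
  let B := TopologicalSpace.countableBasis ℂ
  have hB := TopologicalSpace.isBasis_countableBasis ℂ
  have : Countable B := TopologicalSpace.countable_countableBasis ℂ
  have hopen : ∀ V : B, IsOpen (⋃ n : ℕ, (Complex.exp^[n]) ⁻¹' (V : Set ℂ)) := fun V =>
    isOpen_iUnion fun n => (hB.isOpen V.2).preimage (differentiable_exp_iterate n).continuous
  refine (dense_iInter_of_isOpen hopen fun V => ?_).mono fun z hz => ?_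
  · rw [dense_iff_inter_open]
    intro U hU hne
    obtain ⟨z, hz, m, hm⟩ := exists_exp_iterate_mem hU hne (hB.isOpen V.2)
      (TopologicalSpace.nonempty_of_mem_countableBasis V.2)
    exact ⟨z, hz, mem_iUnion.2 ⟨m, hm⟩⟩
  · refine hB.dense_iff.2 fun V hV _ => ?_
    obtain ⟨n, hn⟩ := mem_iUnion.1 (mem_iInter.1 hz ⟨V, hV⟩)
    exact ⟨_, hn, n, rfl⟩

theorem dense_periodic :
    Dense {z : ℂ | ∃ k : ℕ, 0 < k ∧ ∀ n : ℕ, Complex.exp^[n + k] z = Complex.exp^[n] z} := by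
  rw [dense_iff_inter_open]
  intro U hU hne
  obtain ⟨v, hv, hv0⟩ := hU.exists_ne_zero hne
  obtain ⟨ε, hε, hεU⟩ := Metric.nhds_basis_closedBall.mem_iff.1 (hU.mem_nhds hv)
  have hvpos : 0 < ‖v‖ := norm_pos_iff.2 hv0
  -- The bound ‖v‖ / 2 puts the disc inside the domain of the branch, which then maps it into
  -- itself.
  set ρ := min ε (‖v‖ / 2)
  have hρ : 0 < ρ := lt_min hε (by positivity)
  obtain ⟨m, hm, h⟩ :=
    HasInverseBranch.exists_into_open isOpen_ball ⟨v, mem_ball_self hρ⟩ hv0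
  obtain ⟨p, hp, hfix⟩ := (h.mono le_rfl (closedBall_subset_closedBall (min_le_right _ _))
    ball_subset_closedBall).exists_fixed hρ.le
  refine ⟨p, hεU (closedBall_subset_closedBall (min_le_left _ _) hp), m, hm, fun n => ?_⟩
  rw [Function.iterate_add_apply, hfix]

theorem theorem1p1 :
    Dense {z : ℂ | Tendsto (fun n : ℕ => Complex.exp^[n] z) atTop (Bornology.cobounded ℂ)} ∧
    Dense {z : ℂ | Dense (Set.range (fun n : ℕ => Complex.exp^[n] z))} ∧
    Dense {z : ℂ | ∃ k : ℕ, 0 < k ∧ ∀ n : ℕ, Complex.exp^[n + k] z = Complex.exp^[n] z} :=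
  ⟨dense_escaping, dense_dense_orbit, dense_periodic⟩
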